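/- Let $0\le m\le n$, let $M$ be a smooth manifold of dimension $2n+1$, and let $\eta$ be a smooth contact form on $M$, that is, a smooth $1$-form such that $\eta\wedge(d\eta)^{\wedge n}$ vanishes nowhere. Let $\mathcal R$ be the Reeb vector field of $\eta$, given by $\eta(\mathcal R)=1$ and $d\eta(\mathcal R,\cdot)=0$. For $f\in C^\infty(M)$ let $X_f$ be the contact Hamiltonian vector field of $f$, given by $$\eta(X_f)=-f,\qquad d\eta(X_f,\cdot)=df-\mathcal R(f)\,\eta .$$ Let $\flat\colon TM\to T^*M$ be the isomorphism $\flat(X)=d\eta(X,\cdot)+\eta(X)\eta$, let $\Lambda(\sigma,\nu)=-d\eta(\flat^{-1}\sigma,\flat^{-1}\nu)$, and let $$\{f,g\}_\eta=\Lambda(df,dg)+g\,\mathcal R(f)-f\,\mathcal R(g)$$ be the Jacobi bracket of $\eta$. Write $\iota_{X_0,\dots,X_m}\omega=\omega(X_0,\dots,X_m,\cdot,\dots,\cdot)$, that is, $\iota_{X_0,\dots,X_m}=\iota_{X_m}\cdots\iota_{X_0}$ with $\iota_X$ the interior product (an antiderivation). Let $f_0,\dots,f_m\in C^\infty(M)$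 be in involution, i.e. $\{f_i,f_j\}_\eta=0$ for all $i,j$. Then (whether or not $X_{f_0},\dots,X_{f_m}$ are linearly independent) everywhere on $M$ $$\begin{aligned} \iota_{X_{f_0},\dots,X_{f_m}}\bigl(\eta\wedge(d\eta)^{\wedge n}\bigr) ={}&\frac{n!}{(n-m)!}\,(-1)^{\frac12(m+1)(m+2)}\Bigl[\sum_{j=0}^{m}(-1)^{jm}f_j\,\bigwedge_{r=1}^{m}df_{(j+r)\bmod (m+1)}\Bigr]\wedge (d\eta)^{\wedge(n-m)}\\ &+\frac{n!}{(n-m-1)!}\,(-1)^{\frac12m(m+1)}\,\Bigl(\bigwedge_{j=0}^{m}df_j\Bigr)\wedge\eta\wedge (d\eta)^{\wedge(n-m-1)}, \end{aligned}$$ where wedge products over an index are taken in increasing order of the index, an empty wedge product is $1$, and the second term is read as $0$ when $m=n$. -/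

import Mathlib

open scoped Manifold ContDiff Nat

noncomputable section

namespace ContactGeometry

/-! ### Exterior forms on a finite-dimensional real vector space -/

section Linear

variable {V : Type*} [AddCommGroup V] [Module ℝ V]

/-- The algebra of exterior forms on `V`, that is, the exterior algebra of the dual of `V`.
The wedge product is the multiplication of this algebra. -/
abbrev Forms (V : Type*) [AddCommGroup V] [Module ℝ V] : Type _ :=
  ExteriorAlgebra ℝ (Module.Dual ℝ V)

/-- A linear functional as an exterior form of degree one. -/
def oneForm (α : Module.Dual ℝ V) : Forms V := ExteriorAlgebra.ι ℝ α

/-- An alternating bilinear map `θ` as an exterior form of degree two: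
`θ = (1/2) ∑ i j, θ (e i, e j) e^i ∧ e^j` for a basis `e` with dual basis `e^i`.
The result does not depend on the basis; it is the two-form with `ι_u θ = θ (u, ·)`,
see `contract_twoForm`. -/
def twoForm [FiniteDimensional ℝ V] (θ : V [⋀^Fin 2]→ₗ[ℝ] ℝ) : Forms V :=
  (1 / 2 : ℝ) • ∑ i, ∑ j,
    θ ![Module.finBasis ℝ V i, Module.finBasis ℝ V j] •
      (oneForm ((Module.finBasis ℝ V).coord i) * oneForm ((Module.finBasis ℝ V).coord j))

/-- The contraction (interior product) `ι_v`: the antiderivation of the algebra of forms with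
`ι_v α = α v` for `α` of degree one. -/
def contract (v : V) : Forms V →ₗ[ℝ] Forms V :=
  CliffordAlgebra.contractLeft (Module.Dual.eval ℝ V v)

/-- The iterated contraction `ι_{X 0, …, X (k-1)} θ = θ (X 0, …, X (k-1), ·, …, ·)`, where the
vector `X 0` is inserted first. -/
def iteratedContract : (k : ℕ) → (Fin k → V) → Forms V → Forms V
  | 0, _, θ => θ
  | k + 1, X, θ => contract (X (Fin.last k)) (iteratedContract k (fun i => X i.castSucc) θ)

/-- The functional `θ (v, ·)`. -/
def slot (θ : V [⋀^Fin 2]→ₗ[ℝ] ℝ) (v : V) : Module.Dual ℝ V where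
  toFun w := θ ![v, w]
  map_add' a b := by
    have h : ∀ y, Function.update ![v, 0] 1 y = ![v, y] := fun y => by
      ext i; fin_cases i <;> simp
    have := θ.map_update_add ![v, 0] 1 a b
    rwa [h, h, h] at this
  map_smul' c a := by
    have h : ∀ y, Function.update ![v, 0] 1 y = ![v, y] := fun y => by
      ext i; fin_cases i <;> simp
    have := θ.map_update_smul ![v, 0] 1 c a
    rwa [h, h] at this

@[simp] theorem slot_apply (θ : V [⋀^Fin 2]→ₗ[ℝ] ℝ) (v w : V) : slot θ v w = θ ![v, w] := rfl

theorem slot_swap (θ : V [⋀^Fin 2]→ₗ[ℝ] ℝ) (v w : V) : slot θ v w = -slot θ w v := by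
  have := θ.map_swap ![w, v] (i := 0) (j := 1) (by decide)
  simp only [slot_apply, ← this]
  congr 1
  ext i; fin_cases i <;> simp

theorem slot_self (θ : V [⋀^Fin 2]→ₗ[ℝ] ℝ) (v : V) : slot θ v v = 0 := by
  have := slot_swap θ v v
  linarith

theorem slot_add (θ : V [⋀^Fin 2]→ₗ[ℝ] ℝ) (u v : V) :
    slot θ (u + v) = slot θ u + slot θ v := by
  ext w
  rw [slot_swap, map_add, LinearMap.add_apply, slot_swap θ u, slot_swap θ v]; ring

theorem slot_smul (θ : V [⋀^Fin 2]→ₗ[ℝ] ℝ) (c : ℝ) (v : V) :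
    slot θ (c • v) = c • slot θ v := by
  ext w
  rw [slot_swap, map_smul, LinearMap.smul_apply, slot_swap θ v]; simp

theorem contract_oneForm_mul (v : V) (α : Module.Dual ℝ V) (x : Forms V) :
    contract v (oneForm α * x) = α v • x - oneForm α * contract v x :=
  CliffordAlgebra.contractLeft_ι_mul _ _ _

theorem contract_oneForm (v : V) (α : Module.Dual ℝ V) :
    contract v (oneForm α) = algebraMap ℝ (Forms V) (α v) :=
  CliffordAlgebra.contractLeft_ι (Q := (0 : QuadraticForm ℝ (Module.Dual ℝ V))) _ α

theorem contract_one (v : V) : contract v (1 : Forms V) = 0 :=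
  CliffordAlgebra.contractLeft_one (Q := (0 : QuadraticForm ℝ (Module.Dual ℝ V))) _

theorem oneForm_anticomm (α β : Module.Dual ℝ V) :
    oneForm α * oneForm β = -(oneForm β * oneForm α) :=
  eq_neg_of_add_eq_zero_left (ExteriorAlgebra.ι_add_mul_swap α β)

theorem oneForm_mem (α : Module.Dual ℝ V) : oneForm α ∈ ⋀[ℝ]^1 (Module.Dual ℝ V) := by
  rw [ExteriorAlgebra.exteriorPower, pow_one]; exact ⟨α, rfl⟩

/-- The map `♭ : X ↦ ι_X θ + α(X) α`. -/
def flatMap (α : Module.Dual ℝ V) (θ : V [⋀^Fin 2]→ₗ[ℝ] ℝ) : V →ₗ[ℝ] Module.Dual ℝ V where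
  toFun v := slot θ v + α v • α
  map_add' u v := by rw [slot_add, map_add, add_smul]; abel
  map_smul' c v := by simp [slot_smul, smul_smul, smul_add]

theorem flatMap_apply (α : Module.Dual ℝ V) (θ : V [⋀^Fin 2]→ₗ[ℝ] ℝ) (v w : V) :
    flatMap α θ v w = θ ![v, w] + α v * α w := rfl

theorem flatMap_eq_zero_iff (α : Module.Dual ℝ V) (θ : V [⋀^Fin 2]→ₗ[ℝ] ℝ) (v : V) :
    flatMap α θ v = 0 ↔ α v = 0 ∧ slot θ v = 0 := by
  constructor
  · intro h
    have h0 : α v = 0 := by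
      have := LinearMap.congr_fun h v
      rw [flatMap_apply, ← slot_apply, slot_self] at this
      simpa using this
    refine ⟨h0, ?_⟩
    simpa [flatMap, h0] using h
  · rintro ⟨h1, h2⟩
    simp [flatMap, h1, h2]

variable [FiniteDimensional ℝ V]

theorem oneForm_mul_twoForm (α : Module.Dual ℝ V) (θ : V [⋀^Fin 2]→ₗ[ℝ] ℝ) :
    oneForm α * twoForm θ = twoForm θ * oneForm α := by
  simp only [twoForm, mul_smul_comm, smul_mul_assoc, Finset.mul_sum, Finset.sum_mul]
  refine congrArg _ (Finset.sum_congr rfl fun i _ => Finset.sum_congr rfl fun j _ => ?_)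
  rw [← mul_assoc, oneForm_anticomm α, neg_mul, mul_assoc, oneForm_anticomm α, mul_neg, neg_neg,
    mul_assoc]

/-- The two-form of `θ` acts from the left in a graded Leibniz rule whose first term is
`θ (v, ·)`. -/
theorem contract_twoForm_mul (θ : V [⋀^Fin 2]→ₗ[ℝ] ℝ) (v : V) (x : Forms V) :
    contract v (twoForm θ * x) = oneForm (slot θ v) * x + twoForm θ * contract v x := by
  set b := Module.finBasis ℝ V with hb
  have key : ∀ i j, contract v (oneForm (b.coord i) * oneForm (b.coord j) * x)
      = (b.coord i v • oneForm (b.coord j) - b.coord j v • oneForm (b.coord i)) * x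
        + oneForm (b.coord i) * oneForm (b.coord j) * contract v x := by
    intro i j
    rw [mul_assoc, contract_oneForm_mul, contract_oneForm_mul, mul_sub, sub_mul,
      smul_mul_assoc, smul_mul_assoc, mul_smul_comm, mul_assoc]
    abel
  have hs : slot θ v = ∑ i, ∑ j, (θ ![b i, b j] * b.coord i v) • b.coord j := by
    refine b.ext fun k => ?_
    rw [slot_swap]
    conv_lhs => rw [← b.sum_repr v, map_sum]
    simp only [LinearMap.sum_apply, LinearMap.smul_apply, map_smul, smul_eq_mul,
      Module.Basis.coord_apply, Module.Basis.repr_self, Finsupp.single_apply]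
    rw [← Finset.sum_neg_distrib]
    refine Finset.sum_congr rfl fun i _ => ?_
    rw [slot_swap]
    simp [mul_comm]
  have hs' : slot θ v = -∑ i, ∑ j, (θ ![b i, b j] * b.coord j v) • b.coord i := by
    rw [hs, Finset.sum_comm, ← Finset.sum_neg_distrib]
    refine Finset.sum_congr rfl fun i _ => ?_
    rw [← Finset.sum_neg_distrib]
    refine Finset.sum_congr rfl fun j _ => ?_
    rw [show θ ![b j, b i] = -θ ![b i, b j] from slot_swap θ _ _, neg_mul]
    exact neg_smul (θ ![b i, b j] * b.coord j v) (b.coord i)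
  have h1 : oneForm (slot θ v) = (1 / 2 : ℝ) • ∑ i, ∑ j, θ ![b i, b j] •
      (b.coord i v • oneForm (b.coord j) - b.coord j v • oneForm (b.coord i)) := by
    have : slot θ v = (1 / 2 : ℝ) • (slot θ v + slot θ v) := by
      rw [← two_smul ℝ, smul_smul]; norm_num
    rw [this]
    conv_lhs => rw [hs]; arg 1; arg 2; arg 2; rw [← hs, hs']
    rw [← sub_eq_add_neg]
    simp only [oneForm, map_smul, map_sub, map_sum, smul_sub, Finset.sum_sub_distrib, smul_smul]
  rw [h1]
  simp only [twoForm, ← hb, smul_mul_assoc, Finset.sum_mul, map_smul, map_sum, key, smul_add,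
    Finset.sum_add_distrib]

theorem contract_twoForm (θ : V [⋀^Fin 2]→ₗ[ℝ] ℝ) (v : V) :
    contract v (twoForm θ) = oneForm (slot θ v) := by
  have := contract_twoForm_mul θ v 1
  simpa [contract_one] using this

theorem contract_twoForm_pow (θ : V [⋀^Fin 2]→ₗ[ℝ] ℝ) (v : V) (k : ℕ) :
    contract v (twoForm θ ^ (k + 1)) = ((k : ℝ) + 1) • (oneForm (slot θ v) * twoForm θ ^ k) := by
  induction k with
  | zero => simp [contract_twoForm]
  | succ k ih =>
    rw [pow_succ', contract_twoForm_mul, ih, mul_smul_comm, ← mul_assoc, ← oneForm_mul_twoForm,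
      mul_assoc, ← pow_succ']
    push_cast
    rw [add_smul ((k : ℝ) + 1), one_smul, add_comm]

theorem twoForm_mem (θ : V [⋀^Fin 2]→ₗ[ℝ] ℝ) : twoForm θ ∈ ⋀[ℝ]^2 (Module.Dual ℝ V) := by
  refine Submodule.smul_mem _ _ (Submodule.sum_mem _ fun i _ => Submodule.sum_mem _ fun j _ =>
    Submodule.smul_mem _ _ ?_)
  rw [ExteriorAlgebra.exteriorPower, pow_two]
  exact Submodule.mul_mem_mul ⟨_, rfl⟩ ⟨_, rfl⟩

theorem twoForm_pow_mem (θ : V [⋀^Fin 2]→ₗ[ℝ] ℝ) (k : ℕ) :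
    twoForm θ ^ k ∈ ⋀[ℝ]^(2 * k) (Module.Dual ℝ V) := by
  rw [ExteriorAlgebra.exteriorPower, pow_mul]
  exact Submodule.pow_mem_pow _ (twoForm_mem θ) k

/-- Forms of degree larger than the dimension vanish. -/
theorem eq_zero_of_degree {k : ℕ} (hk : Module.finrank ℝ V < k) {x : Forms V}
    (hx : x ∈ ⋀[ℝ]^k (Module.Dual ℝ V)) : x = 0 := by
  have h : Module.finrank ℝ (⋀[ℝ]^k (Module.Dual ℝ V)) = 0 := by
    rw [exteriorPower.finrank_eq, Subspace.dual_finrank_eq]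
    exact Nat.choose_eq_zero_of_lt hk
  have := Module.finrank_zero_iff.mp h
  exact congrArg Subtype.val (Subsingleton.elim (⟨x, hx⟩ : ⋀[ℝ]^k (Module.Dual ℝ V)) 0)

theorem flatMap_injective {n : ℕ} (hV : Module.finrank ℝ V = 2 * n + 1)
    (α : Module.Dual ℝ V) (θ : V [⋀^Fin 2]→ₗ[ℝ] ℝ) (h : oneForm α * twoForm θ ^ n ≠ 0) :
    Function.Injective (flatMap α θ) := by
  refine (injective_iff_map_eq_zero _).mpr fun v hv => ?_
  obtain ⟨h1, h2⟩ := (flatMap_eq_zero_iff α θ v).mp hv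
  by_contra hne
  obtain ⟨β, hβ⟩ : ∃ β : Module.Dual ℝ V, β v ≠ 0 := by
    by_contra! hall
    exact hne ((Module.forall_dual_apply_eq_zero_iff ℝ v).mp hall)
  have hz : oneForm β * (oneForm α * twoForm θ ^ n) = 0 := by
    refine eq_zero_of_degree (k := 1 + (1 + 2 * n)) (by omega) ?_
    exact SetLike.mul_mem_graded (oneForm_mem β)
      (SetLike.mul_mem_graded (oneForm_mem α) (twoForm_pow_mem θ n))
  have hc : contract v (oneForm α * twoForm θ ^ n) = 0 := by
    rw [contract_oneForm_mul, h1, zero_smul]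
    cases n with
    | zero => simp [contract_one]
    | succ k => rw [contract_twoForm_pow, h2]; simp [oneForm]
  have := congrArg (contract v) hz
  rw [contract_oneForm_mul, hc, mul_zero, sub_zero, map_zero] at this
  exact h ((smul_eq_zero.mp this).resolve_left hβ)

theorem flatMap_surjective {n : ℕ} (hV : Module.finrank ℝ V = 2 * n + 1)
    (α : Module.Dual ℝ V) (θ : V [⋀^Fin 2]→ₗ[ℝ] ℝ) (h : oneForm α * twoForm θ ^ n ≠ 0) :
    Function.Surjective (flatMap α θ) :=
  (LinearMap.injective_iff_surjective_of_finrank_eq_finrank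
    Subspace.dual_finrank_eq.symm).mp (flatMap_injective hV α θ h)

theorem existsUnique_reebVector {n : ℕ} (hV : Module.finrank ℝ V = 2 * n + 1)
    (α : Module.Dual ℝ V) (θ : V [⋀^Fin 2]→ₗ[ℝ] ℝ) (h : oneForm α * twoForm θ ^ n ≠ 0) :
    ∃! v : V, α v = 1 ∧ ∀ w, θ ![v, w] = 0 := by
  obtain ⟨v, hv⟩ := flatMap_surjective hV α θ h α
  have hv' : ∀ w, θ ![v, w] + α v * α w = α w := fun w => LinearMap.congr_fun hv w
  have h1 : α v = 1 := by
    have hvv := hv' v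
    rw [← slot_apply, slot_self, zero_add] at hvv
    rcases mul_right_eq_self₀.mp hvv with h1 | h0
    · exact h1
    · exfalso
      have hs : slot θ v = α := by
        ext w
        simpa [h0] using hv' w
      have hz : twoForm θ ^ (n + 1) = 0 :=
        eq_zero_of_degree (k := 2 * (n + 1)) (by omega) (twoForm_pow_mem θ (n + 1))
      have := contract_twoForm_pow θ v n
      rw [hz, map_zero, hs] at this
      exact h ((smul_eq_zero.mp this.symm).resolve_left (by positivity))
  refine ⟨v, ⟨h1, fun w => by simpa [h1] using hv' w⟩, ?_⟩
  rintro u ⟨hu1, hu2⟩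
  refine flatMap_injective hV α θ h ?_
  rw [hv]
  ext w
  rw [flatMap_apply, hu1, hu2, zero_add, one_mul]

theorem existsUnique_hamiltonianVector {n : ℕ} (hV : Module.finrank ℝ V = 2 * n + 1)
    (α : Module.Dual ℝ V) (θ : V [⋀^Fin 2]→ₗ[ℝ] ℝ) (h : oneForm α * twoForm θ ^ n ≠ 0)
    {r : V} (hr : α r = 1 ∧ ∀ w, θ ![r, w] = 0) (c : ℝ) (β : Module.Dual ℝ V) :
    ∃! v : V, α v = -c ∧ ∀ w, θ ![v, w] = β w - β r * α w := by
  obtain ⟨v, hv⟩ := flatMap_surjective hV α θ h (β - β r • α - c • α)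
  have hv' : ∀ w, θ ![v, w] + α v * α w = β w - β r * α w - c * α w :=
    fun w => LinearMap.congr_fun hv w
  have h1 : α v = -c := by
    have h2 := hv' r
    have h3 : θ ![v, r] = 0 := by
      rw [← slot_apply, slot_swap, slot_apply, hr.2, neg_zero]
    rw [h3, hr.1] at h2
    linarith
  refine ⟨v, ⟨h1, fun w => ?_⟩, ?_⟩
  · have := hv' w
    rw [h1] at this
    linarith
  · rintro u ⟨hu1, hu2⟩
    refine flatMap_injective hV α θ h ?_
    rw [hv]
    ext w
    rw [flatMap_apply, hu1, hu2]
    simp only [LinearMap.sub_apply, LinearMap.smul_apply, smul_eq_mul]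
    ring

end Linear

/-! ### Contact forms on smooth manifolds -/

section Manifold

variable {n : ℕ} {M : Type*} [TopologicalSpace M]
  [ChartedSpace (EuclideanSpace ℝ (Fin (2 * n + 1))) M]

instance finiteDimensional_tangentSpace (x : M) :
    FiniteDimensional ℝ (TangentSpace (𝓡 (2 * n + 1)) x) :=
  inferInstanceAs (FiniteDimensional ℝ (EuclideanSpace ℝ (Fin (2 * n + 1))))

theorem finrank_tangentSpace (x : M) :
    Module.finrank ℝ (TangentSpace (𝓡 (2 * n + 1)) x) = 2 * n + 1 :=
  finrank_euclideanSpace_fin (𝕜 := ℝ)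

/-- The one-form `η` read in the preferred chart `φ` at `x₀`: the pullback of `η` under the
inverse of `φ`. -/
def oneFormInChart (η : ∀ x : M, TangentSpace (𝓡 (2 * n + 1)) x →L[ℝ] ℝ) (x₀ : M)
    (y : EuclideanSpace ℝ (Fin (2 * n + 1))) : EuclideanSpace ℝ (Fin (2 * n + 1)) →L[ℝ] ℝ :=
  (η ((extChartAt (𝓡 (2 * n + 1)) x₀).symm y)).comp
    (mfderiv (𝓡 (2 * n + 1)) (𝓡 (2 * n + 1)) (extChartAt (𝓡 (2 * n + 1)) x₀).symm y)

/-- The exterior derivative of a one-form on a manifold at the point `x`: the exterior derivative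
of the form read in the preferred chart at `x`, pulled back by that chart. -/
def extDerivOneForm (η : ∀ x : M, TangentSpace (𝓡 (2 * n + 1)) x →L[ℝ] ℝ) (x : M) :
    TangentSpace (𝓡 (2 * n + 1)) x [⋀^Fin 2]→ₗ[ℝ] ℝ :=
  ((extDeriv (fun y => ContinuousAlternatingMap.ofSubsingleton ℝ
        (EuclideanSpace ℝ (Fin (2 * n + 1))) ℝ (0 : Fin 1) (oneFormInChart η x y))
      (extChartAt (𝓡 (2 * n + 1)) x x)).compContinuousLinearMap
    (mfderiv (𝓡 (2 * n + 1)) (𝓡 (2 * n + 1))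
      (extChartAt (𝓡 (2 * n + 1)) x) x)).toAlternatingMap

/-- The differential `df` of a function at the point `x`, as a linear functional. -/
def differential (f : M → ℝ) (x : M) : Module.Dual ℝ (TangentSpace (𝓡 (2 * n + 1)) x) :=
  (mfderiv (𝓡 (2 * n + 1)) 𝓘(ℝ, ℝ) f x).toLinearMap

variable [IsManifold (𝓡 (2 * n + 1)) ∞ M]

/-- A contact form on a manifold of dimension `2 * n + 1`: a smooth one-form `η` such that
`η ∧ (dη)^n` vanishes nowhere. -/
structure ContactForm (n : ℕ) (M : Type*) [TopologicalSpace M]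
    [ChartedSpace (EuclideanSpace ℝ (Fin (2 * n + 1))) M]
    [IsManifold (𝓡 (2 * n + 1)) ∞ M] where
  toFun : ∀ x : M, TangentSpace (𝓡 (2 * n + 1)) x →L[ℝ] ℝ
  contMDiff : ContMDiff (𝓡 (2 * n + 1))
    ((𝓡 (2 * n + 1)).prod 𝓘(ℝ, EuclideanSpace ℝ (Fin (2 * n + 1)) →L[ℝ] ℝ)) ∞
    (fun x => Bundle.TotalSpace.mk' (EuclideanSpace ℝ (Fin (2 * n + 1)) →L[ℝ] ℝ)
      (E := fun x : M => TangentSpace (𝓡 (2 * n + 1)) x →L[ℝ] Bundle.Trivial M ℝ x)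
      x (toFun x))
  volume_ne_zero : ∀ x : M,
    oneForm (toFun x).toLinearMap * twoForm (extDerivOneForm toFun x) ^ n ≠ 0

namespace ContactForm

variable (η : ContactForm n M)

/-- `η` at the point `x`, as a linear functional. -/
def covector (x : M) : Module.Dual ℝ (TangentSpace (𝓡 (2 * n + 1)) x) := (η.toFun x).toLinearMap

/-- `dη` at the point `x`, as an alternating bilinear map. -/
def d (x : M) : TangentSpace (𝓡 (2 * n + 1)) x [⋀^Fin 2]→ₗ[ℝ] ℝ := extDerivOneForm η.toFun x

/-- The contact volume form `η ∧ (dη)^n`. -/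
def volumeForm (x : M) : Forms (TangentSpace (𝓡 (2 * n + 1)) x) :=
  oneForm (η.covector x) * twoForm (η.d x) ^ n

theorem volumeForm_ne_zero (x : M) : oneForm (η.covector x) * twoForm (η.d x) ^ n ≠ 0 :=
  η.volume_ne_zero x

theorem existsUnique_reeb (x : M) :
    ∃! v : TangentSpace (𝓡 (2 * n + 1)) x, η.covector x v = 1 ∧ ∀ w, η.d x ![v, w] = 0 :=
  existsUnique_reebVector (finrank_tangentSpace x) _ _ (η.volumeForm_ne_zero x)

/-- The Reeb vector field: `η(R) = 1` and `dη(R, ·) = 0`. -/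
def reeb (x : M) : TangentSpace (𝓡 (2 * n + 1)) x := (η.existsUnique_reeb x).choose

theorem reeb_spec (x : M) : η.covector x (η.reeb x) = 1 ∧ ∀ w, η.d x ![η.reeb x, w] = 0 :=
  (η.existsUnique_reeb x).choose_spec.1

theorem existsUnique_hamiltonianField (f : M → ℝ) (x : M) :
    ∃! v : TangentSpace (𝓡 (2 * n + 1)) x, η.covector x v = -f x ∧
      ∀ w, η.d x ![v, w] =
        differential f x w - differential f x (η.reeb x) * η.covector x w :=
  existsUnique_hamiltonianVector (finrank_tangentSpace x) _ _ (η.volumeForm_ne_zero x)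
    (η.reeb_spec x) (f x) (differential f x)

/-- The contact Hamiltonian vector field of `f`: `η(X_f) = -f` and `dη(X_f, ·) = df - R(f) η`. -/
def hamiltonianField (f : M → ℝ) (x : M) : TangentSpace (𝓡 (2 * n + 1)) x :=
  (η.existsUnique_hamiltonianField f x).choose

theorem hamiltonianField_spec (f : M → ℝ) (x : M) :
    η.covector x (η.hamiltonianField f x) = -f x ∧
      ∀ w, η.d x ![η.hamiltonianField f x, w] =
        differential f x w - differential f x (η.reeb x) * η.covector x w :=
  (η.existsUnique_hamiltonianField f x).choose_spec.1

/-- The isomorphism `♭ : X ↦ dη(X, ·) + η(X) η` of tangent and cotangent spaces. -/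
def flat (x : M) :
    TangentSpace (𝓡 (2 * n + 1)) x ≃ₗ[ℝ] Module.Dual ℝ (TangentSpace (𝓡 (2 * n + 1)) x) :=
  LinearEquiv.ofBijective (flatMap (η.covector x) (η.d x))
    ⟨flatMap_injective (finrank_tangentSpace x) _ _ (η.volumeForm_ne_zero x),
      flatMap_surjective (finrank_tangentSpace x) _ _ (η.volumeForm_ne_zero x)⟩

/-- The bivector field `Λ(σ, ν) = -dη(♭⁻¹ σ, ♭⁻¹ ν)` of the Jacobi structure of `η`. -/
def bivector (x : M) (σ ν : Module.Dual ℝ (TangentSpace (𝓡 (2 * n + 1)) x)) : ℝ :=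
  -η.d x ![(η.flat x).symm σ, (η.flat x).symm ν]

/-- The Jacobi bracket `{f, g} = Λ(df, dg) - g E(f) + f E(g)` of the Jacobi structure `(Λ, E)` of
`η`, where `E = -R`. -/
def jacobiBracket (f g : M → ℝ) (x : M) : ℝ :=
  η.bivector x (differential f x) (differential g x)
    - g x * differential f x (-η.reeb x) + f x * differential g x (-η.reeb x)

end ContactForm

end Manifold

end ContactGeometry

end

open scoped Manifold ContDiff Nat

namespace ContactGeometry

/-! ### Interior products and ordered products of one-forms. -/

section Linear

variable {V : Type*} [AddCommGroup V] [Module ℝ V]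

/-! The identity is pointwise, so it is linear algebra on one tangent space. Write `α` for `η`, `θ`
for `dη`, `β i` for the differential of `f i`, and `r i` for its value on the Reeb vector. The
Hamiltonian vectors satisfy `α (X i) = -f i` and `slot θ (X i) = β i - r i • α`. Involution becomes
`β i (X j) = -f i * r j` (`jacobiBracket_eq`): on the vector `X j`, the `β i` take values
proportional to the `f i`.

Let `B` be the ordered product of the first `k` of the `β i`, and `A` its alternating sum with one
factor replaced by its `f i`. Proportionality gives `ι B = -r • A` and `ι A = 0` for contraction by
the next vector. So the span of the two shapes `A ∧ θ^(n+1-k)` and `B ∧ α ∧ θ^(n-k)` is carried by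
each contraction into the span for `k + 1`, which gives the induction `iteratedContract_volume`. The
only unwanted terms, multiples of `r • A ∧ α ∧ θ^(n-k)`, arise once from `ι θ` and once from `ι B`,
and cancel. Independence of the vectors plays no role.

The cyclically ordered sum equals `A` by `sum_cyclic_eq_altSum`. -/

/-- The contraction is an antiderivation. -/
theorem contract_mul (v : V) (x y : Forms V) :
    contract v (x * y) = contract v x * y + CliffordAlgebra.involute x * contract v y := by
  induction x using CliffordAlgebra.left_induction generalizing y with
  | algebraMap r =>
    rw [AlgHom.commutes, ← Algebra.smul_def, ← Algebra.smul_def, map_smul,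
      Algebra.algebraMap_eq_smul_one, map_smul]
    erw [contract_one]
    simp
  | add a b ha hb => rw [add_mul, map_add, ha, hb, map_add, map_add, add_mul, add_mul]; abel
  | ι_mul x m hx =>
    change contract v (oneForm m * x * y) = contract v (oneForm m * x) * y + _
    have h : CliffordAlgebra.involute (oneForm m * x) =
        -(oneForm m * CliffordAlgebra.involute x) := by
      rw [map_mul, ← neg_mul]
      exact congrArg (· * _) (CliffordAlgebra.involute_ι m)
    erw [h]
    rw [mul_assoc, contract_oneForm_mul, contract_oneForm_mul, hx, sub_mul, mul_add,
      smul_mul_assoc, neg_mul, mul_assoc, mul_assoc]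
    abel

theorem involute_oneForm (α : Module.Dual ℝ V) :
    CliffordAlgebra.involute (oneForm α) = -oneForm α :=
  CliffordAlgebra.involute_ι α

theorem oneForm_mul_self (α : Module.Dual ℝ V) : oneForm α * oneForm α = 0 :=
  ExteriorAlgebra.ι_sq_zero α

/-- The product of the one-forms in a list. -/
def wedgeList (L : List (Module.Dual ℝ V)) : Forms V := (L.map oneForm).prod

theorem wedgeList_append (L L' : List (Module.Dual ℝ V)) :
    wedgeList (L ++ L') = wedgeList L * wedgeList L' := by
  simp [wedgeList]

theorem wedgeList_singleton (β : Module.Dual ℝ V) : wedgeList [β] = oneForm β := by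
  simp [wedgeList]

theorem wedgeList_cons (β : Module.Dual ℝ V) (L : List (Module.Dual ℝ V)) :
    wedgeList (β :: L) = oneForm β * wedgeList L := by
  simp [wedgeList]

theorem involute_wedgeList (L : List (Module.Dual ℝ V)) :
    CliffordAlgebra.involute (wedgeList L) = (-1 : ℝ) ^ L.length • wedgeList L := by
  induction L with
  | nil => simp [wedgeList]
  | cons β L ih =>
    rw [wedgeList_cons, map_mul, ih, involute_oneForm, List.length_cons, pow_succ, mul_smul_comm]
    simp

theorem oneForm_mul_wedgeList (β : Module.Dual ℝ V) (L : List (Module.Dual ℝ V)) :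
    oneForm β * wedgeList L = (-1 : ℝ) ^ L.length • (wedgeList L * oneForm β) := by
  induction L with
  | nil => simp [wedgeList]
  | cons γ L ih =>
    rw [wedgeList_cons, ← mul_assoc, oneForm_anticomm, neg_mul, mul_assoc, ih, List.length_cons,
      pow_succ, mul_smul_comm, mul_assoc]
    simp

theorem wedgeList_mul_wedgeList (L L' : List (Module.Dual ℝ V)) :
    wedgeList L * wedgeList L' =
      (-1 : ℝ) ^ (L.length * L'.length) • (wedgeList L' * wedgeList L) := by
  induction L with
  | nil => simp [wedgeList]
  | cons γ L ih =>
    rw [wedgeList_cons, mul_assoc, ih, mul_smul_comm, ← mul_assoc, oneForm_mul_wedgeList,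
      smul_mul_assoc, smul_smul, ← pow_add, mul_assoc, List.length_cons, add_mul, one_mul]

theorem ιMulti_eq_wedgeList (k : ℕ) (β : Fin k → Module.Dual ℝ V) :
    ExteriorAlgebra.ιMulti ℝ k β = wedgeList (List.ofFn β) := by
  rw [ExteriorAlgebra.ιMulti_apply, wedgeList, List.map_ofFn]
  rfl

/-- The sum `∑ j, (-1)^j f j • (β 0 ∧ … ∧ β (j-1) ∧ β (j+1) ∧ … ∧ β (k-1))`. -/
def altSum (k : ℕ) (f : Fin k → ℝ) (β : Fin k → Module.Dual ℝ V) : Forms V :=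
  ∑ j : Fin k, ((-1 : ℝ) ^ (j : ℕ) * f j) •
    (wedgeList ((List.ofFn β).take j) * wedgeList ((List.ofFn β).drop (j + 1)))

theorem wedgeList_ofFn_succ {k : ℕ} (β : Fin (k + 1) → Module.Dual ℝ V) :
    wedgeList (List.ofFn β) =
      wedgeList (List.ofFn fun i => β i.castSucc) * oneForm (β (Fin.last k)) := by
  rw [List.ofFn_succ', List.concat_eq_append, wedgeList_append, wedgeList_singleton]

theorem altSum_succ {k : ℕ} (f : Fin (k + 1) → ℝ) (β : Fin (k + 1) → Module.Dual ℝ V) :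
    altSum (k + 1) f β =
      altSum k (fun i => f i.castSucc) (fun i => β i.castSucc) * oneForm (β (Fin.last k)) +
        ((-1 : ℝ) ^ k * f (Fin.last k)) • wedgeList (List.ofFn fun i => β i.castSucc) := by
  rw [altSum, Fin.sum_univ_castSucc, altSum, Finset.sum_mul]
  congr 1
  · refine Finset.sum_congr rfl fun j _ => ?_
    have hj := j.2
    rw [List.ofFn_succ', List.concat_eq_append, Fin.val_castSucc,
      List.take_append_of_le_length (by simp),
      List.drop_append_of_le_length (by simp), wedgeList_append, wedgeList_singleton,
      smul_mul_assoc, mul_assoc]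
  · rw [List.ofFn_succ', List.concat_eq_append, Fin.val_last,
      List.take_append_of_le_length (by simp), List.take_of_length_le (by simp),
      List.drop_of_length_le (by simp)]
    simp [wedgeList]

theorem involute_altSum {k : ℕ} (f : Fin k → ℝ) (β : Fin k → Module.Dual ℝ V) :
    CliffordAlgebra.involute (altSum k f β) = (-1 : ℝ) ^ (k + 1) • altSum k f β := by
  induction k with
  | zero => simp [altSum]
  | succ k ih =>
    rw [altSum_succ, map_add, map_mul, ih, map_smul, involute_wedgeList, involute_oneForm,
      List.length_ofFn, smul_add, smul_mul_assoc, mul_neg, smul_comm, pow_succ (-1 : ℝ) (k + 1),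
      pow_succ (-1 : ℝ) k]
    simp

/-! ### Cyclic order against increasing order. -/

/-- Addition in `Fin (m + 1)` wraps around: starting just after `j`, the indices run to the end and
then from `0` up to `j - 1`, skipping only `j`. -/
theorem ofFn_add_succ {A : Type*} {m : ℕ} (β : Fin (m + 1) → A) (j : Fin (m + 1)) :
    List.ofFn (fun r : Fin m => β (j + r.succ)) =
      (List.ofFn β).drop (j + 1) ++ (List.ofFn β).take j := by
  have hj := j.2
  refine List.ext_getElem (by simp; omega) fun i hi _ => ?_
  rw [List.length_ofFn] at hi
  rw [List.getElem_append]
  split_ifs with h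
  · rw [List.length_drop, List.length_ofFn] at h
    simp only [List.getElem_ofFn, List.getElem_drop]
    congr 1
    ext
    rw [Fin.val_add, Fin.val_succ, Nat.mod_eq_of_lt] <;> simp only <;> omega
  · rw [List.length_drop, List.length_ofFn] at h
    simp only [List.getElem_ofFn, List.getElem_take, List.length_drop, List.length_ofFn]
    congr 1
    ext
    rw [Fin.val_add, Fin.val_succ, Nat.mod_eq_sub_mod (by simp only; omega), Nat.mod_eq_of_lt] <;>
      simp only <;> omega

/-- The alternating sum written with cyclically ordered products. -/
theorem sum_cyclic_eq_altSum {m : ℕ} (f : Fin (m + 1) → ℝ)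
    (β : Fin (m + 1) → Module.Dual ℝ V) :
    ∑ j : Fin (m + 1), ((-1 : ℝ) ^ ((j : ℕ) * m) * f j) •
      ExteriorAlgebra.ιMulti ℝ m (fun r : Fin m => β (j + r.succ)) = altSum (m + 1) f β := by
  refine Finset.sum_congr rfl fun j _ => ?_
  obtain ⟨c, hc⟩ : ∃ c, m = j + c := ⟨m - j, by omega⟩
  rw [ιMulti_eq_wedgeList, ofFn_add_succ, wedgeList_append, wedgeList_mul_wedgeList, smul_smul,
    List.length_drop, List.length_take, List.length_ofFn, min_eq_left (by omega),
    show m + 1 - (j + 1) = c by omega]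
  congr 1
  -- Swapping the blocks of lengths `c` and `j` costs `(-1)^(c * j)`. Since `m = j + c`, the total
  -- exponent is `j * j` plus an even number, which has the parity of `j`.
  have h : (-1 : ℝ) ^ ((j : ℕ) * m) * (-1) ^ (c * (j : ℕ)) = (-1) ^ (j : ℕ) := by
    have he : (j : ℕ) * m + c * j = j * j + 2 * (c * j) := by
      have := congrArg ((j : ℕ) * ·) hc
      rw [this]
      ring
    rw [← pow_add, he, pow_add, pow_mul (-1 : ℝ) 2, pow_mul]
    rcases neg_one_pow_eq_or ℝ (j : ℕ) with h | h <;> simp [h]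
  rw [← h]
  ring

/-! ### Contraction by a vector on which the one-forms are proportional to `f`. -/

section Involution

variable {k : ℕ} {f : Fin k → ℝ} {β : Fin k → Module.Dual ℝ V} {v : V} {r : ℝ}

/-- By the antiderivation rule the `i`-th factor contributes `(-1)^i * β i v` times the product of
the others; the common factor `-r` comes out. -/
theorem contract_wedgeList_ofFn (h : ∀ i, β i v = -f i * r) :
    contract v (wedgeList (List.ofFn β)) = -r • altSum k f β := by
  induction k with
  | zero => simp [altSum, wedgeList, contract_one]
  | succ k ih =>
    rw [wedgeList_ofFn_succ, contract_mul, ih (f := fun i => f i.castSucc) fun i => h _,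
      involute_wedgeList, contract_oneForm, altSum_succ, h, List.length_ofFn, smul_add,
      smul_mul_assoc, smul_smul, ← Algebra.commutes, ← Algebra.smul_def, smul_smul]
    congr 2
    ring

/-- For `r ≠ 0` this is `ι_v ∘ ι_v = 0` applied to the full product. The induction avoids dividing
by `r`: the two terms involving the last index cancel. -/
theorem contract_altSum (h : ∀ i, β i v = -f i * r) : contract v (altSum k f β) = 0 := by
  induction k with
  | zero => simp [altSum]
  | succ k ih =>
    rw [altSum_succ, map_add, contract_mul, ih (f := fun i => f i.castSucc) fun i => h _,
      involute_altSum, contract_oneForm, map_smul,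
      contract_wedgeList_ofFn (f := fun i => f i.castSucc) (r := r) fun i => h _, h,
      zero_mul, zero_add, ← Algebra.commutes, ← Algebra.smul_def, smul_smul, smul_smul,
      ← add_smul]
    convert zero_smul ℝ _ using 2
    ring

end Involution

/-! ### Iterated contraction of the volume form. -/

theorem neg_one_pow_triangle (k : ℕ) :
    (-1 : ℝ) ^ ((k + 1) * (k + 2) / 2) = (-1) ^ (k + 1) * (-1) ^ (k * (k + 1) / 2) := by
  rw [← pow_add]
  congr 1
  rw [show (k + 1) * (k + 2) = k * (k + 1) + (k + 1) * 2 by ring,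
    Nat.add_mul_div_right _ _ two_pos, add_comm]

variable [FiniteDimensional ℝ V]

theorem contract_twoForm_pow_pred (θ : V [⋀^Fin 2]→ₗ[ℝ] ℝ) (v : V) (q : ℕ) :
    contract v (twoForm θ ^ q) = (q : ℝ) • (oneForm (slot θ v) * twoForm θ ^ (q - 1)) := by
  cases q with
  | zero => simp [contract_one]
  | succ q => rw [contract_twoForm_pow]; simp

/-- The iterated contraction of `α ∧ θ^n` by `k` vectors in involution. -/
theorem iteratedContract_volume (n : ℕ) (α : Module.Dual ℝ V) (θ : V [⋀^Fin 2]→ₗ[ℝ] ℝ) {k : ℕ}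
    (X : Fin k → V) (f r : Fin k → ℝ) (β : Fin k → Module.Dual ℝ V)
    (hα : ∀ i, α (X i) = -f i) (hθ : ∀ i, slot θ (X i) = β i - r i • α)
    (hβ : ∀ i j, β i (X j) = -f i * r j) :
    iteratedContract k X (oneForm α * twoForm θ ^ n) =
      ((n.descFactorial (k - 1) : ℝ) * (-1) ^ (k * (k + 1) / 2)) •
          (altSum k f β * twoForm θ ^ (n + 1 - k)) +
        ((n.descFactorial k : ℝ) * (-1) ^ (k * (k - 1) / 2)) •
          (wedgeList (List.ofFn β) * (oneForm α * twoForm θ ^ (n - k))) := by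
  induction k with
  | zero => simp [iteratedContract, altSum, wedgeList]
  | succ k ih =>
    have hA := contract_altSum (v := X (Fin.last k)) (f := fun i : Fin k => f i.castSucc)
      (β := fun i => β i.castSucc) (r := r (Fin.last k)) fun i => hβ _ _
    have hB := contract_wedgeList_ofFn (v := X (Fin.last k)) (f := fun i : Fin k => f i.castSucc)
      (β := fun i => β i.castSucc) (r := r (Fin.last k)) fun i => hβ _ _
    have hs : oneForm (slot θ (X (Fin.last k))) =
        oneForm (β (Fin.last k)) - r (Fin.last k) • oneForm α := by
      rw [hθ]; simp [oneForm]
    -- The `r • α` part of `slot θ X` dies against `α`, so no `r` enters the second shape this way.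
    have hαs (y : Forms V) : oneForm α * (oneForm (slot θ (X (Fin.last k))) * y) =
        -(oneForm (β (Fin.last k)) * (oneForm α * y)) := by
      rw [hs, ← mul_assoc, mul_sub, mul_smul_comm, oneForm_mul_self, smul_zero, sub_zero,
        oneForm_anticomm, neg_mul, mul_assoc]
    have hsign : (-1 : ℝ) ^ (k * (k + 1) / 2) = (-1) ^ k * (-1) ^ (k * (k - 1) / 2) := by
      cases k with
      | zero => simp
      | succ k =>
        rw [neg_one_pow_triangle]
        congr 3
        simp [mul_comm]
    -- At `k = 0` truncated subtraction makes `k - 1` equal to `0` and the factorial recursion fails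
    -- for `n > 0`, but the alternating sum is then empty.
    have hd : altSum k (fun i => f i.castSucc) (fun i => β i.castSucc) = 0 ∨
        (n.descFactorial (k - 1) : ℝ) * ((n + 1 - k : ℕ) : ℝ) = n.descFactorial k := by
      cases k with
      | zero => left; simp [altSum]
      | succ k =>
        right
        rw [Nat.descFactorial_succ]
        push_cast
        simp [mul_comm]
    have hsq : (-1 : ℝ) ^ k * (-1) ^ k = 1 := by rw [← mul_pow]; simp
    rw [iteratedContract, ih (fun i => X i.castSucc) (fun i => f i.castSucc)
      (fun i => r i.castSucc) (fun i => β i.castSucc) (fun i => hα _) (fun i => hθ _)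
      (fun i j => hβ _ _)]
    rw [map_add, map_smul, map_smul, contract_mul, contract_mul, contract_oneForm_mul, hA, hB,
      contract_twoForm_pow_pred, contract_twoForm_pow_pred, involute_altSum, involute_wedgeList,
      mul_smul_comm (α := ℝ) _ (oneForm α), hαs, hs, hα, List.length_ofFn, altSum_succ,
      wedgeList_ofFn_succ, neg_one_pow_triangle,
      show n + 1 - k - 1 = n - k by omega, show n + 1 - (k + 1) = n - k by omega,
      show n - k - 1 = n - (k + 1) by omega, Nat.add_sub_cancel, Nat.descFactorial_succ n k,
      mul_comm (k + 1) k, hsign]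
    set A := altSum k (fun i => f i.castSucc) (fun i => β i.castSucc)
    set B := wedgeList (List.ofFn fun i : Fin k => β i.castSucc)
    set b := oneForm (β (Fin.last k))
    set a := oneForm α
    set T := twoForm θ ^ (n - k)
    set t := (-1 : ℝ) ^ (k * (k - 1) / 2)
    have hd' (c e : ℝ) (y : Forms V) :
        ((n.descFactorial (k - 1) : ℝ) * c) • ((n + 1 - k : ℕ) : ℝ) • e • (A * y) =
          ((n.descFactorial k : ℝ) * c * e) • (A * y) := by
      rcases hd with h | h
      · simp [h]
      · rw [smul_smul, smul_smul, ← h]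
        congr 1
        ring
    simp only [smul_mul_assoc, mul_smul_comm, smul_add, smul_sub, mul_sub, sub_mul, add_mul,
      neg_mul, mul_neg, smul_neg, mul_assoc, zero_mul, zero_add, neg_smul]
    rw [smul_smul (r (Fin.last k)) ((-1) ^ (k + 1)), hd', hd', pow_succ, Nat.cast_mul]
    generalize A * (b * T) = Y₁, A * (a * T) = Y₂, B * T = Y₃,
      B * (b * (a * twoForm θ ^ (n - (k + 1)))) = Y₄
    generalize (-1 : ℝ) ^ k = s at hsq ⊢
    -- The four coefficients, in the order of `Y₁` to `Y₄`. That of `Y₂` is the cancellation of the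
    -- `r` terms; that of `Y₃` supplies the new last summand of the alternating sum.
    match_scalars
    · ring
    · linear_combination (n.descFactorial k * t * r (Fin.last k)) * hsq
    · linear_combination (n.descFactorial k * t * f (Fin.last k) * s) * hsq
    · ring

end Linear

end ContactGeometry

/-! ### The Jacobi bracket through Hamiltonian fields. -/

namespace ContactGeometry.ContactForm

variable {n : ℕ} {M : Type*} [TopologicalSpace M]
  [ChartedSpace (EuclideanSpace ℝ (Fin (2 * n + 1))) M]
  [IsManifold (𝓡 (2 * n + 1)) ∞ M] (η : ContactForm n M)

/-- `♭` sends the Reeb vector to `η` and `X_f` to `df - (R(f) + f) η`; the Reeb correction restores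
`df`. -/
theorem flat_symm_differential (f : M → ℝ) (x : M) :
    (η.flat x).symm (differential f x) =
      η.hamiltonianField f x + (differential f x (η.reeb x) + f x) • η.reeb x := by
  rw [LinearEquiv.symm_apply_eq]
  obtain ⟨h1, h2⟩ := η.hamiltonianField_spec f x
  obtain ⟨h3, h4⟩ := η.reeb_spec x
  ext w
  rw [map_add, map_smul]
  change _ = flatMap _ _ _ w + _ * flatMap _ _ _ w
  rw [flatMap_apply, flatMap_apply, h1, h2, h3, h4]
  ring

/-- The Reeb vector lies in the kernel of `dη`, so `Λ(df, dg) = -dη(X_f, X_g) = -df(X_g) - g R(f)`,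
and the last term cancels the `g R(f)` in the bracket. -/
theorem jacobiBracket_eq (f g : M → ℝ) (x : M) :
    η.jacobiBracket f g x = -differential f x (η.hamiltonianField g x) -
      f x * differential g x (η.reeb x) := by
  obtain ⟨h1, h2⟩ := η.hamiltonianField_spec g x
  obtain ⟨h3, h4⟩ := η.reeb_spec x
  obtain ⟨h5, h6⟩ := η.hamiltonianField_spec f x
  have h7 : slot (η.d x) (η.reeb x) = 0 := LinearMap.ext h4
  have h8 : slot (η.d x) (η.hamiltonianField f x) (η.reeb x) = 0 := by
    rw [slot_swap, h7]; simp
  rw [jacobiBracket, bivector, flat_symm_differential, flat_symm_differential, ← slot_apply,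
    slot_add, slot_smul, h7, smul_zero, add_zero, map_add, map_smul, h8, slot_apply, h6, h1,
    map_neg, map_neg]
  simp only [smul_zero]
  ring

end ContactGeometry.ContactForm

theorem mainTheorem8 {n m : ℕ} (hmn : m ≤ n) {M : Type*} [TopologicalSpace M]
    [ChartedSpace (EuclideanSpace ℝ (Fin (2 * n + 1))) M]
    [IsManifold (𝓡 (2 * n + 1)) ∞ M]
    (η : ContactGeometry.ContactForm n M)
    (f : Fin (m + 1) → C^∞⟮𝓡 (2 * n + 1), M; ℝ⟯)
    (hinv : ∀ i j : Fin (m + 1), ∀ x : M, η.jacobiBracket (f i) (f j) x = 0)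
    (x : M) :
    ContactGeometry.iteratedContract (m + 1) (fun i => η.hamiltonianField (f i) x)
        (η.volumeForm x) =
      (((n ! : ℝ) / ((n - m)! : ℝ)) * (-1 : ℝ) ^ ((m + 1) * (m + 2) / 2)) •
          ((∑ j : Fin (m + 1), ((-1 : ℝ) ^ ((j : ℕ) * m) * f j x) •
              ExteriorAlgebra.ιMulti ℝ m
                (fun r : Fin m => ContactGeometry.differential (f (j + r.succ)) x)) *
            ContactGeometry.twoForm (η.d x) ^ (n - m)) +
        if m < n then
          (((n ! : ℝ) / ((n - m - 1)! : ℝ)) * (-1 : ℝ) ^ (m * (m + 1) / 2)) •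
            (ExteriorAlgebra.ιMulti ℝ (m + 1)
                (fun j : Fin (m + 1) => ContactGeometry.differential (f j) x) *
              ContactGeometry.oneForm (η.covector x) *
              ContactGeometry.twoForm (η.d x) ^ (n - m - 1))
        else 0 := by
  have hdiff (i j : Fin (m + 1)) := (η.jacobiBracket_eq (f i) (f j) x).symm.trans (hinv i j x)
  have h := ContactGeometry.iteratedContract_volume n (η.covector x) (η.d x)
    (fun i => η.hamiltonianField (f i) x) (fun i => f i x)
    (fun i => ContactGeometry.differential (f i) x (η.reeb x))
    (fun i => ContactGeometry.differential (f i) x)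
    (fun i => (η.hamiltonianField_spec (f i) x).1)
    (fun i => LinearMap.ext (η.hamiltonianField_spec (f i) x).2)
    (fun i j => by linear_combination -hdiff i j)
  rw [ContactGeometry.ContactForm.volumeForm, h,
    ContactGeometry.sum_cyclic_eq_altSum (fun j => f j x)
      (fun j => ContactGeometry.differential (f j) x),
    ContactGeometry.ιMulti_eq_wedgeList, Nat.add_sub_cancel, Nat.add_sub_add_right,
    Nat.descFactorial_eq_div hmn, Nat.cast_div (Nat.factorial_dvd_factorial (Nat.sub_le _ _))
      (by positivity), mul_comm (m + 1) m]
  congr 1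
  split_ifs with hlt
  · rw [Nat.descFactorial_eq_div hlt,
      Nat.cast_div (Nat.factorial_dvd_factorial (Nat.sub_le _ _)) (by positivity), Nat.sub_sub,
      mul_assoc]
  -- Here `m = n`, and the falling factorial of `n` of length `n + 1` vanishes.
  · rw [Nat.descFactorial_of_lt (by omega)]
    simp
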